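/- Let $(Q,\omega)$ be any symplectic manifold (a smooth finite-dimensional manifold without boundary with a smooth, closed, nondegenerate $2$-form $\omega$; $Q$ need not be compact), let $(\Sigma,j)$ be a compact connected Riemann surface (without boundary), oriented by its complex structure $j$, and let $u:\Sigma\to Q$ be a $\mathcal{C}^1$-map with positive symplectic area $\int_\Sigma u^*\omega>0$. Then the isotropy group $$G_u:=\{\psi:(\Sigma,j)\to(\Sigma,j)\ \text{biholomorphic}\mid u\circ\psi=u\},$$ with composition as the group operation, is finite. -/

import Mathlib

open scoped Manifold ContDiff

noncomputable section

/-- A (not necessarily continuous) differential `2`-form on a real manifold `M` modelled on the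
normed space `F`: an alternating bilinear form on every tangent space. -/
abbrev TwoForm (F : Type*) [NormedAddCommGroup F] [NormedSpace ℝ F]
    (M : Type*) [TopologicalSpace M] [ChartedSpace F M] : Type _ :=
  ∀ p : M, (TangentSpace 𝓘(ℝ, F) p) [⋀^Fin 2]→L[ℝ] ℝ

/-- The pullback `(f^* Ω)_x (v, w) = Ω_{f x} (df_x v, df_x w)` of a `2`-form. -/
def TwoForm.pullback {E F M N : Type*} [NormedAddCommGroup E] [NormedSpace ℝ E]
    [NormedAddCommGroup F] [NormedSpace ℝ F]
    [TopologicalSpace M] [ChartedSpace E M] [TopologicalSpace N] [ChartedSpace F N]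
    (f : M → N) (Ω : TwoForm F N) : TwoForm E M :=
  fun x ↦ (Ω (f x)).compContinuousLinearMap (mfderiv 𝓘(ℝ, E) 𝓘(ℝ, F) f x)

/-- The expression of a `2`-form in a chart `e`: its pullback under `e⁻¹`, a `2`-form on the model
vector space. It is meaningful on `e.target`. -/
def TwoForm.inChart {F M : Type*} [NormedAddCommGroup F] [NormedSpace ℝ F]
    [TopologicalSpace M] [ChartedSpace F M] (Ω : TwoForm F M) (e : OpenPartialHomeomorph M F) :
    F → F [⋀^Fin 2]→L[ℝ] ℝ :=
  TwoForm.pullback (E := F) (M := F) e.symm Ω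

/-- A symplectic form: a smooth, closed, nondegenerate `2`-form. -/
structure IsSymplecticForm {F M : Type*} [NormedAddCommGroup F] [NormedSpace ℝ F]
    [TopologicalSpace M] [ChartedSpace F M] (Ω : TwoForm F M) : Prop where
  smooth : ∀ e ∈ atlas F M, ContDiffOn ℝ ∞ (Ω.inChart e) e.target
  closed : ∀ e ∈ atlas F M, ∀ y ∈ e.target, extDeriv (Ω.inChart e) y = 0
  nondegenerate : ∀ (p : M) (v : TangentSpace 𝓘(ℝ, F) p), v ≠ 0 →
    ∃ w : TangentSpace 𝓘(ℝ, F) p, Ω p ![v, w] ≠ 0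

section RiemannSurface

variable (S : Type*) [TopologicalSpace S] [T2Space S] [CompactSpace S] [ChartedSpace ℂ S]

/-- On a compact surface there is a partition of unity `ρ_x`, indexed by the points `x`, such that
the closed support of `ρ_x` lies in the domain of the preferred chart at `x`. -/
theorem exists_chartPartition :
    ∃ ρ : PartitionOfUnity S S, ρ.IsSubordinate fun x ↦ (chartAt ℂ x).source := by
  refine PartitionOfUnity.exists_isSubordinate isClosed_univ _
    (fun x ↦ (chartAt ℂ x).open_source) ?_
  intro x _
  exact Set.mem_iUnion.2 ⟨x, mem_chart_source ℂ x⟩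

/-- A choice of a partition of unity subordinate to the charts of a compact surface. -/
def chartPartition : PartitionOfUnity S S := (exists_chartPartition S).choose

variable {S}

/-- The integral `∫_S α` of a `2`-form `α` over a compact Riemann surface `S`, with the orientation
given by the complex structure: if `α = a_x ds ∧ dt` in the holomorphic coordinate `z = s + i t`
given by the chart at `x`, that is `a_x = α (∂_s, ∂_t)`, then
`∫_S α = ∑_x ∫ ρ_x a_x ds dt` for a partition of unity `ρ` subordinate to the charts (only finitely
many `ρ_x` are nonzero). For continuous `α` the value does not depend on the choice of `ρ`. -/
def surfaceIntegral (α : TwoForm ℂ S) : ℝ :=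
  ∑ᶠ x : S, ∫ z in (chartAt ℂ x).target,
    chartPartition S x ((chartAt ℂ x).symm z) * α.inChart (chartAt ℂ x) z ![1, Complex.I]

end RiemannSurface

/-- The isotropy group of a map `u` on a Riemann surface `S`: the biholomorphic maps `ψ : S → S`
(holomorphic bijections with holomorphic inverse) such that `u ∘ ψ = u`, with composition. -/
def isotropyGroup {S Q : Type*} [TopologicalSpace S] [ChartedSpace ℂ S] (u : S → Q) :
    Subgroup (Equiv.Perm S) where
  carrier := {ψ | ContMDiff 𝓘(ℂ) 𝓘(ℂ) ω ψ ∧ ContMDiff 𝓘(ℂ) 𝓘(ℂ) ω ψ.symm ∧ u ∘ ψ = u}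
  one_mem' := ⟨contMDiff_id, contMDiff_id, rfl⟩
  mul_mem' := by
    rintro φ ψ ⟨h1, h2, h3⟩ ⟨k1, k2, k3⟩
    refine ⟨h1.comp k1, k2.comp h2, ?_⟩
    funext x
    exact (congrFun h3 (ψ x)).trans (congrFun k3 x)
  inv_mem' := by
    rintro ψ ⟨h1, h2, h3⟩
    refine ⟨h2, h1, ?_⟩
    funext x
    have h := congrFun h3 (ψ.symm x)
    simp only [Function.comp_apply, Equiv.apply_symm_apply] at h
    exact h.symm

end

open scoped Manifold ContDiff

open Set Filter Topology MeasureTheory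

/-! Nonzero area forces `du` to be injective at some `p`, else `u^*Ω` vanishes. Near `u p`, a chart
followed by a left inverse of `du_p` turns `u` into an equidimensional map `f`, a local
diffeomorphism at `p`. By Sard, `f` has a regular value `f x`, so `u` is locally injective at every
point of the fiber through `x`; this fiber is discrete and compact, hence finite. Evaluation at `x`
embeds the isotropy group in it: an element fixing `x` is the identity near `x` by local injectivity
of `u`, hence everywhere by the identity theorem. -/

theorem IsManifold.restrictScalars_real {S : Type*} [TopologicalSpace S] [ChartedSpace ℂ S]
    (n : ℕ∞ω) [IsManifold 𝓘(ℂ) n S] : IsManifold 𝓘(ℝ, ℂ) n S := by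
  refine isManifold_of_contDiffOn _ _ _ fun e e' he he' ↦ ?_
  have h := (contDiffGroupoid n 𝓘(ℂ)).compatible he he'
  rw [contDiffGroupoid, mem_groupoid_of_pregroupoid] at h
  exact ContDiffOn.restrict_scalars ℝ h.1

/-- Identity theorem for holomorphic self-maps of a connected Riemann surface. -/
theorem ContMDiff.eq_id_of_eventuallyEq {S : Type*} [TopologicalSpace S] [T2Space S]
    [ConnectedSpace S] [ChartedSpace ℂ S] {ψ : S → S} (hψ : ContMDiff 𝓘(ℂ) 𝓘(ℂ) ω ψ)
    {x : S} (hx : ∀ᶠ y in 𝓝 x, ψ y = y) : ψ = id := by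
  let A : Set S := {x | ∀ᶠ y in 𝓝 x, ψ y = y}
  have hAo : IsOpen A := isOpen_setOfPred_eventually_nhds
  have hAc : IsClosed A := by
    refine isClosed_of_closure_subset fun y hy ↦ ?_
    have hψy : ψ y = y := by
      have hcl : IsClosed {z | ψ z = z} := isClosed_eq hψ.continuous continuous_id
      exact closure_minimal (fun z hz ↦ hz.self_of_nhds) hcl hy
    by_contra hyA
    set e := chartAt ℂ y with he
    have hye : y ∈ e.source := mem_chart_source ℂ y
    have han : AnalyticAt ℂ (e ∘ ψ ∘ e.symm) (e y) := by
      have h := (contMDiffAt_iff.1 (hψ y)).2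
      simp only [mfld_simps, hψy] at h
      exact (contDiffWithinAt_univ.1 h).analyticAt
    have hsymm : e.symm (e y) = y := e.left_inv hye
    have hcont : Tendsto e.symm (𝓝 (e y)) (𝓝 y) := by
      simpa [hsymm] using (e.continuousAt_symm (e.map_source hye)).tendsto
    -- The puncture is harmless: `y ∉ A`, so the points of `A` accumulating at `y` differ from `y`.
    have hfreq : ∃ᶠ z in 𝓝[≠] (e y), (e ∘ ψ ∘ e.symm) z = id z := by
      have h1 : ∃ᶠ w in 𝓝 y, w ∈ A ∧ w ∈ e.source := by
        refine (mem_closure_iff_frequently.1 hy).and_eventually (e.open_source.mem_nhds hye)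
      have h2 : ∃ᶠ z in 𝓝 (e y), e.symm z ∈ A ∧ z ∈ e.target := by
        rw [← e.map_nhds_eq hye, frequently_map]
        refine h1.mono fun w hw ↦ ⟨?_, e.map_source hw.2⟩
        rw [e.left_inv hw.2]; exact hw.1
      rw [frequently_nhdsWithin_iff]
      refine h2.mono fun z hz ↦ ⟨?_, ?_⟩
      · have : ψ (e.symm z) = e.symm z := hz.1.self_of_nhds
        simp [this, e.right_inv hz.2]
      · rintro rfl
        rw [hsymm] at hz
        exact hyA hz.1
    have hev := (han.frequently_eq_iff_eventually_eq analyticAt_id).1 hfreq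
    apply hyA
    have hty : ∀ᶠ w in 𝓝 y, ψ w ∈ e.source :=
      hψ.continuous.continuousAt.eventually (by rw [hψy]; exact e.open_source.mem_nhds hye)
    filter_upwards [(e.continuousAt hye).eventually hev, hty, e.open_source.mem_nhds hye]
      with w h1 h2 h3
    have h1' : e (ψ w) = e w := by simpa [e.left_inv h3] using h1
    exact e.injOn h2 h3 h1'
  have hA : A = univ := IsClopen.eq_univ ⟨hAc, hAo⟩ ⟨x, hx⟩
  funext z
  have : z ∈ A := hA ▸ mem_univ z
  exact this.self_of_nhds

/-- A `C^1` map between manifolds of equal dimension that is a local diffeomorphism somewhere has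
a value all of whose preimages are points of local injectivity. -/
theorem exists_forall_fiber_injOn_nhds {E M : Type*} [NormedAddCommGroup E] [NormedSpace ℝ E]
    [FiniteDimensional ℝ E] [TopologicalSpace M] [CompactSpace M] [ChartedSpace E M]
    [IsManifold 𝓘(ℝ, E) 1 M] {f : M → E} {O : Set M} (hO : IsOpen O)
    (hf : ContMDiffOn 𝓘(ℝ, E) 𝓘(ℝ, E) 1 f O) {p : M} (hp : p ∈ O) {A : E ≃L[ℝ] E}
    (hA : HasFDerivAt (f ∘ (chartAt E p).symm) (A : E →L[ℝ] E) (chartAt E p p)) :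
    ∃ x ∈ O, ∀ y ∈ O, f y = f x → ∃ W ∈ 𝓝 y, InjOn f W := by
  borelize E
  let D : M → Set E := fun s ↦ (chartAt E s).target ∩ (chartAt E s).symm ⁻¹' O
  have hDo (s) : IsOpen (D s) := (chartAt E s).isOpen_inter_preimage_symm hO
  have hg (s) : ContDiffOn ℝ 1 (f ∘ (chartAt E s).symm) (D s) := by
    rw [← contMDiffOn_iff_contDiffOn]
    exact hf.comp ((contMDiffOn_chart_symm (I := 𝓘(ℝ, E)) (x := s)).mono inter_subset_left)
      inter_subset_right
  have hstrict {s : M} {z : E} (hz : z ∈ D s) : HasStrictFDerivAt (f ∘ (chartAt E s).symm)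
      (fderiv ℝ (f ∘ (chartAt E s).symm) z) z :=
    ((hg s).contDiffAt ((hDo s).mem_nhds hz)).hasStrictFDerivAt (by simp)
  let C : M → Set E := fun s ↦ {z ∈ D s | (fderiv ℝ (f ∘ (chartAt E s).symm) z).det = 0}
  have hnull (s) : (Measure.addHaar : Measure E) ((f ∘ (chartAt E s).symm) '' C s) = 0 :=
    addHaar_image_eq_zero_of_det_fderivWithin_eq_zero _
      (fun z hz ↦ (hstrict hz.1).hasFDerivAt.hasFDerivWithinAt) fun z hz ↦ hz.2
  -- Finitely many charts suffice, so the critical values of `f` form a null set.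
  obtain ⟨t, ht⟩ := isCompact_univ.elim_finite_subcover (fun s : M ↦ (chartAt E s).source)
    (fun s ↦ (chartAt E s).open_source) fun s _ ↦ mem_iUnion.2 ⟨s, mem_chart_source E s⟩
  have hBnull : (Measure.addHaar : Measure E) (⋃ s ∈ t, (f ∘ (chartAt E s).symm) '' C s) = 0 :=
    (measure_biUnion_null_iff t.countable_toSet).2 fun s _ ↦ hnull s
  have hpD : chartAt E p p ∈ D p :=
    ⟨mem_chart_target E p, by simpa [(chartAt E p).left_inv (mem_chart_source E p)] using hp⟩
  have hopen : (f ∘ (chartAt E p).symm) '' D p ∈ 𝓝 ((f ∘ (chartAt E p).symm) (chartAt E p p)) := by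
    have h := hstrict hpD
    rw [hA.fderiv] at h
    rw [← h.map_nhds_eq_of_equiv]
    exact image_mem_map ((hDo p).mem_nhds hpD)
  -- The image contains a neighbourhood of `f p`, which has positive measure.
  obtain ⟨w, ⟨z, hzD, rfl⟩, hwB⟩ : ∃ w ∈ (f ∘ (chartAt E p).symm) '' D p,
      w ∉ ⋃ s ∈ t, (f ∘ (chartAt E s).symm) '' C s := by
    by_contra! hcon
    exact (Measure.measure_pos_of_mem_nhds Measure.addHaar hopen).ne' (measure_mono_null hcon hBnull)
  refine ⟨(chartAt E p).symm z, hzD.2, fun y hy hyz ↦ ?_⟩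
  obtain ⟨s, hst, hys⟩ := mem_iUnion₂.1 (ht (mem_univ y))
  set e := chartAt E s
  have hey : e.symm (e y) = y := e.left_inv hys
  have hyD : e y ∈ D s := ⟨e.map_source hys, by simpa [e, hey] using hy⟩
  have hdet : (fderiv ℝ (f ∘ e.symm) (e y)).det ≠ 0 := fun h0 ↦
    hwB (mem_iUnion₂.2 ⟨s, hst, e y, ⟨hyD, h0⟩, by simpa [e, hey] using hyz⟩)
  have h := hstrict hyD
  rw [← ContinuousLinearMap.coe_toContinuousLinearEquivOfDetNeZero _ hdet] at h
  let Φ := h.toOpenPartialHomeomorph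
  refine ⟨e.source ∩ e ⁻¹' Φ.source, inter_mem (e.open_source.mem_nhds hys)
    ((e.continuousAt hys).preimage_mem_nhds ?_), ?_⟩
  · exact Φ.open_source.mem_nhds h.mem_toOpenPartialHomeomorph_source
  · intro a ha b hb hab
    refine e.injOn ha.1 hb.1 (Φ.injOn ha.2 hb.2 ?_)
    change (f ∘ e.symm) (e a) = (f ∘ e.symm) (e b)
    simpa [e.left_inv ha.1, e.left_inv hb.1] using hab

/-- A map with nonzero area integrand is an immersion somewhere. -/
theorem exists_injective_mfderiv_of_surfaceIntegral_ne_zero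
    {F : Type*} [NormedAddCommGroup F] [NormedSpace ℝ F]
    {Q : Type*} [TopologicalSpace Q] [ChartedSpace F Q] (Ω : TwoForm F Q)
    {S : Type*} [TopologicalSpace S] [T2Space S] [CompactSpace S] [ChartedSpace ℂ S]
    (u : S → Q) (h : surfaceIntegral (Ω.pullback u) ≠ 0) :
    ∃ p : S, Function.Injective (mfderiv 𝓘(ℝ, ℂ) 𝓘(ℝ, F) u p) := by
  by_contra! hcon
  apply h
  refine finsum_eq_zero_of_forall_eq_zero fun x ↦ ?_
  refine integral_eq_zero_of_ae (Eventually.of_forall fun z ↦ ?_)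
  suffices (Ω.pullback u).inChart (chartAt ℂ x) z ![1, Complex.I] = 0 by simp [this]
  set p := (chartAt ℂ x).symm z with hp
  let B : ℂ →L[ℝ] ℂ := mfderiv 𝓘(ℝ, ℂ) 𝓘(ℝ, ℂ) (chartAt ℂ x).symm z
  let A : ℂ →L[ℝ] F := mfderiv 𝓘(ℝ, ℂ) 𝓘(ℝ, F) u p
  let w : F [⋀^Fin 2]→L[ℝ] ℝ := Ω (u p)
  have hA : ¬ Function.Injective A := hcon p
  -- Invertibility of `B` need not be known: if `A ∘ B` is injective, so is `B`, which is then onto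
  -- by dimension.
  have hBA : ¬ Function.Injective (A ∘ B) := fun hi ↦ hA <| by
    have hB : Function.Injective B := hi.of_comp
    have hB' : Function.Surjective B := LinearMap.surjective_of_injective (f := B.toLinearMap) hB
    intro a b hab
    obtain ⟨a, rfl⟩ := hB' a
    obtain ⟨b, rfl⟩ := hB' b
    rw [hi hab]
  change w (fun i ↦ A (B (![1, Complex.I] i))) = 0
  have hli : ¬ LinearIndependent ℝ (fun i ↦ A (B (![1, Complex.I] i)) : Fin 2 → F) := by
    intro hl
    apply hBA
    change Function.Injective (A.comp B)
    rw [injective_iff_map_eq_zero]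
    intro c hc
    have hc' : c = c.re • (1 : ℂ) + c.im • Complex.I := by simp
    rw [hc', map_add, map_smul, map_smul] at hc
    have := Fintype.linearIndependent_iff.1 hl ![c.re, c.im] (by simpa [Fin.sum_univ_two] using hc)
    apply Complex.ext
    · simpa using this 0
    · simpa using this 1
  exact w.toAlternatingMap.map_linearDependent _ hli

/-- If a `C^1` map on a compact manifold is an immersion somewhere, then some fiber is finite and
contained in the set of points of local injectivity. -/
theorem exists_finite_fiber_of_injective_mfderiv
    {E : Type*} [NormedAddCommGroup E] [NormedSpace ℝ E] [FiniteDimensional ℝ E]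
    {F : Type*} [NormedAddCommGroup F] [NormedSpace ℝ F] [FiniteDimensional ℝ F]
    {Q : Type*} [TopologicalSpace Q] [T2Space Q] [ChartedSpace F Q] [IsManifold 𝓘(ℝ, F) 1 Q]
    {M : Type*} [TopologicalSpace M] [CompactSpace M] [ChartedSpace E M]
    [IsManifold 𝓘(ℝ, E) 1 M] {u : M → Q} (hu : ContMDiff 𝓘(ℝ, E) 𝓘(ℝ, F) 1 u) {p : M}
    (hp : Function.Injective (mfderiv 𝓘(ℝ, E) 𝓘(ℝ, F) u p)) :
    ∃ x : M, (u ⁻¹' {u x}).Finite ∧ ∃ W ∈ 𝓝 x, InjOn u W := by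
  let A : E →L[ℝ] F := mfderiv 𝓘(ℝ, E) 𝓘(ℝ, F) u p
  obtain ⟨l, hl⟩ := A.toLinearMap.exists_leftInverse_of_injective (LinearMap.ker_eq_bot.2 hp)
  let L : F →L[ℝ] E := LinearMap.toContinuousLinearMap l
  let O : Set M := u ⁻¹' (chartAt F (u p)).source
  have hO : IsOpen O := (chartAt F (u p)).open_source.preimage hu.continuous
  let f : M → E := L ∘ chartAt F (u p) ∘ u
  have hf : ContMDiffOn 𝓘(ℝ, E) 𝓘(ℝ, E) 1 f O :=
    L.contMDiff.comp_contMDiffOn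
      ((contMDiffOn_chart (I := 𝓘(ℝ, F))).comp hu.contMDiffOn subset_rfl)
  have hder : HasFDerivAt (f ∘ (chartAt E p).symm)
      ((ContinuousLinearEquiv.refl ℝ E : E ≃L[ℝ] E) : E →L[ℝ] E) (chartAt E p p) := by
    have h := ((hu p).mdifferentiableAt (by simp)).hasMFDerivAt.2
    simp only [mfld_simps] at h
    have h' : HasFDerivAt (chartAt F (u p) ∘ u ∘ (chartAt E p).symm) A (chartAt E p p) :=
      hasFDerivWithinAt_univ.1 h
    have h2 : HasFDerivAt (f ∘ (chartAt E p).symm) (L.comp A) (chartAt E p p) :=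
      L.hasFDerivAt.comp _ h'
    convert h2
    ext v
    exact (LinearMap.congr_fun hl v).symm
  obtain ⟨x, hxO, hx⟩ := exists_forall_fiber_injOn_nhds hO hf (mem_chart_source F (u p)) hder
  -- On `O`, `f` factors through `u`, so fibers of `u` lie in fibers of `f`, and injectivity of `f`
  -- passes to `u`.
  have hinj : ∀ y, u y = u x → ∃ W ∈ 𝓝 y, InjOn u W := fun y hy ↦ by
    obtain ⟨W, hW, hWi⟩ := hx y (by simpa [O, hy] using hxO) (by simp [f, hy])
    refine ⟨W, hW, fun a ha b hb hab ↦ hWi ha hb (by simp [f, hab])⟩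
  refine ⟨x, ?_, hinj x rfl⟩
  have hc : IsCompact (u ⁻¹' {u x}) := (isClosed_singleton.preimage hu.continuous).isCompact
  refine hc.finite (IsDiscrete.of_nhdsWithin fun y hy ↦ ?_)
  obtain ⟨W, hW, hWi⟩ := hinj y hy
  rw [le_pure_iff]
  filter_upwards [mem_nhdsWithin_of_mem_nhds hW, self_mem_nhdsWithin] with z hzW hzu
  exact hWi hzW (mem_of_mem_nhds hW) (hzu.trans hy.symm)

theorem isotropyGroup_finite_of_finite_fiber {S Q : Type*} [TopologicalSpace S] [T2Space S]
    [ConnectedSpace S] [ChartedSpace ℂ S] {u : S → Q} {x : S} (hfin : (u ⁻¹' {u x}).Finite)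
    {W : Set S} (hW : W ∈ 𝓝 x) (hinj : InjOn u W) : Finite (isotropyGroup u) := by
  have := hfin.to_subtype
  refine Finite.of_injective (β := u ⁻¹' {u x})
    (fun ψ ↦ ⟨ψ.1 x, congrFun ψ.2.2.2 x⟩) fun φ ψ h ↦ ?_
  have hx : φ.1 x = ψ.1 x := congrArg Subtype.val h
  obtain ⟨hc, -, huc⟩ := (φ⁻¹ * ψ).2
  set χ : Equiv.Perm S := (φ⁻¹ * ψ : isotropyGroup u).1 with hχ
  have hχx : χ x = x := by
    simp [hχ, ← hx]
  have hid : (χ : S → S) = id := by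
    refine hc.eq_id_of_eventuallyEq (x := x) ?_
    -- Near `x` both `y` and `χ y` lie in `W`, with equal images under `u`.
    filter_upwards [hW, hc.continuous.continuousAt.eventually (by rwa [hχx])] with y hy hχy
    exact hinj hχy hy (congrFun huc y)
  have h1 : φ⁻¹ * ψ = 1 := Subtype.ext (Equiv.ext fun y ↦ congrFun hid y)
  exact inv_mul_eq_one.1 h1

theorem lemma3
    -- the symplectic manifold `(Q, Ω)`
    {F : Type*} [NormedAddCommGroup F] [NormedSpace ℝ F] [FiniteDimensional ℝ F]
    {Q : Type*} [TopologicalSpace Q] [T2Space Q] [SecondCountableTopology Q]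
    [ChartedSpace F Q] [IsManifold 𝓘(ℝ, F) ∞ Q]
    (Ω : TwoForm F Q) (hΩ : IsSymplecticForm Ω)
    -- the compact connected Riemann surface `S`
    {S : Type*} [TopologicalSpace S] [T2Space S] [CompactSpace S] [ConnectedSpace S]
    [ChartedSpace ℂ S] [IsManifold 𝓘(ℂ) ω S]
    -- the `C^1` map `u` (with respect to the underlying real structure of `S`)
    (u : S → Q) (hu : ContMDiff 𝓘(ℝ, ℂ) 𝓘(ℝ, F) 1 u)
    (harea : 0 < surfaceIntegral (Ω.pullback u)) :
    Finite (isotropyGroup u) := by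
  have : IsManifold 𝓘(ℝ, ℂ) 1 S := by
    have : IsManifold 𝓘(ℂ) 1 S := IsManifold.of_le (n := ω) le_top
    exact IsManifold.restrictScalars_real 1
  have : IsManifold 𝓘(ℝ, F) 1 Q := IsManifold.of_le (n := ∞) (by simp)
  obtain ⟨p, hp⟩ := exists_injective_mfderiv_of_surfaceIntegral_ne_zero Ω u harea.ne'
  obtain ⟨x, hfin, W, hW, hinj⟩ := exists_finite_fiber_of_injective_mfderiv hu hp
  exact isotropyGroup_finite_of_finite_fiber hfin hW hinj
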